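/- Let $n\ge 0$, $t>0$, $s_t=1-e^{-2t}$, and let $$\varphi_t(x,y)=(2\pi s_t)^{-n/2}\exp\Big(-\frac{|y-e^{-t}x|^2}{2s_t}\Big),\qquad x,y\in\mathbb R^n,$$ be the transition density of the Ornstein–Uhlenbeck process $dX_t=-X_t\,dt+\sqrt2\,dW_t$ on $\mathbb R^n$. For functions $f$ and probability measures $\mu$ on $\mathbb R^n$ write $$P_tf(x)=\int\varphi_t(x,y)f(y)\,dy,\qquad P_t\mu(dz)=\Big(\int\varphi_t(x,z)\,\mu(dx)\Big)dz .$$ Let $K\subset\mathbb R^n$ be compact, let $S_K(t)\ge 0$ be a constant, and assume the log-Harnack inequality $$P_t(\log f)(y)\le \log P_tf(x)+S_K(t)\,|x-y|$$ for all $x,y\in K$ and all Borel functions $f:\mathbb R^n\to(0,\infty)$ that are bounded and bounded away from $0$. Then for any two Borel probability measures $\mu,\nu$ supported in $K$ and any coupling $\pi$ of $\mu$ and $\nu$, $$\mathrm{KL}(P_t\nu\,\|\,P_t\mu)\le\iint|x-y|\,S_K(t)\,\pi(dx,dy)=S_K(t)\iint|x-y|\,\pi(dx,dy),$$ and consequently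 $$\mathrm{KL}(P_t\nu\,\|\,P_t\mu)\le S_K(t)\,W_1(\mu,\nu)\le S_K(t)\,W_2(\mu,\nu),$$ where $W_p(\mu,\nu)=\big(\inf_\pi\iint|x-y|^p\,\pi(dx,dy)\big)^{1/p}$, the infimum being over all couplings $\pi$ of $\mu$ and $\nu$. -/

import Mathlib

open scoped ENNReal NNReal

namespace OrnsteinUhlenbeck

/-- Variance `s_t = 1 - e^{-2t}` of the process `dX = -X dt + √2 dW` started at a point. -/
noncomputable def var (t : ℝ) : ℝ := 1 - Real.exp (-2 * t)

/-- The Mehler kernel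
`φ_t(x, y) = (2π s_t)^{-n/2} exp (-|y - e^{-t} x|² / (2 s_t))`, for `t > 0`. -/
noncomputable def mehler {n : ℕ} (t : ℝ) (x y : EuclideanSpace ℝ (Fin n)) : ℝ :=
  (2 * Real.pi * var t) ^ (-(n : ℝ) / 2) *
    Real.exp (-‖y - Real.exp (-t) • x‖ ^ 2 / (2 * var t))

/-- The semigroup on functions, `P_t f(x) = ∫ φ_t(x, y) f(y) dy`. -/
noncomputable def semigroup {n : ℕ} (t : ℝ) (f : EuclideanSpace ℝ (Fin n) → ℝ)
    (x : EuclideanSpace ℝ (Fin n)) : ℝ :=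
  ∫ y, mehler t x y * f y

/-- The semigroup on measures, `P_t μ (dz) = (∫ φ_t(x, z) μ(dx)) dz`. -/
noncomputable def evolve {n : ℕ} (t : ℝ) (μ : MeasureTheory.Measure (EuclideanSpace ℝ (Fin n))) :
    MeasureTheory.Measure (EuclideanSpace ℝ (Fin n)) :=
  MeasureTheory.volume.withDensity (fun z => ∫⁻ x, ENNReal.ofReal (mehler t x z) ∂μ)

/-- The pointwise log-Harnack inequality at time `t` on `K` with constant `S`:
`P_t (log f)(y) ≤ log (P_t f(x)) + S |x - y|` for all `x, y ∈ K` and all Borel functions `f`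
that are bounded and bounded away from zero, i.e. `f = e^φ` with `φ` bounded Borel. -/
def LogHarnackOn {n : ℕ} (t : ℝ) (K : Set (EuclideanSpace ℝ (Fin n))) (S : ℝ) : Prop :=
  ∀ f : EuclideanSpace ℝ (Fin n) → ℝ, Measurable f →
    (∃ c : ℝ, 0 < c ∧ ∀ z, c ≤ f z) → (∃ C : ℝ, ∀ z, f z ≤ C) →
    ∀ x ∈ K, ∀ y ∈ K,
      semigroup t (fun z => Real.log (f z)) y ≤ Real.log (semigroup t f x) + S * dist x y

end OrnsteinUhlenbeck

namespace OptimalTransport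

/-- `γ` is a coupling of `μ` and `ν`: a measure on the product with these marginals. -/
def IsCoupling {X : Type*} [MeasurableSpace X] (γ : MeasureTheory.Measure (X × X))
    (μ ν : MeasureTheory.Measure X) : Prop :=
  γ.map Prod.fst = μ ∧ γ.map Prod.snd = ν

/-- The Wasserstein distance
`W_p(μ, ν) = (inf over couplings γ of ∫ d(x, y)^p γ(dx, dy))^{1/p}`, with values in `[0, ∞]`. -/
noncomputable def wasserstein {X : Type*} [MeasurableSpace X] [PseudoEMetricSpace X] (p : ℝ)
    (μ ν : MeasureTheory.Measure X) : ℝ≥0∞ :=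
  (⨅ γ : {γ : MeasureTheory.Measure (X × X) // IsCoupling γ μ ν},
    ∫⁻ q, edist q.1 q.2 ^ p ∂γ.1) ^ (1 / p)

end OptimalTransport

/-! By Donsker–Varadhan duality, `KL(Q‖P) ≤ C` follows once `∫ log g dQ ≤ log ∫ g dP + C` for all
test functions `g` bounded and bounded away from zero, exactly the class in the log-Harnack
hypothesis. Take `Q = P_tν`, `P = P_tμ`. Fubini (`integral_evolve`) gives `∫ log g dP_tν = ∫ P_t(log
g) dν`. Integrating log-Harnack against a coupling bounds this by `∫ log P_t g dμ + S ∫ |x-y| dγ`,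
and Jensen moves the logarithm outside the `μ`-integral. Thus `C = S ∫ |x-y| dγ`; minimising over
`γ` gives `W_1`, and Hölder gives `W_1 ≤ W_2`. -/

open MeasureTheory Filter Topology InformationTheory

/-! ### Jensen's inequality for the logarithm. -/

namespace MeasureTheory

variable {Ω : Type*} [MeasurableSpace Ω]

theorem Integrable.of_measurable_of_bounds {P : Measure Ω} [IsFiniteMeasure P] {g : Ω → ℝ}
    (hg : Measurable g) {c C : ℝ} (h : ∀ z, c ≤ g z) (h' : ∀ z, g z ≤ C) : Integrable g P :=
  Integrable.of_mem_Icc c C hg.aemeasurable (ae_of_all _ fun z => ⟨h z, h' z⟩)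

/-- Integrate the tangent-line bound `log u ≤ u - 1` at `u = g / ∫ g`. -/
theorem integral_log_le_log_integral {P : Measure Ω} [IsProbabilityMeasure P] {g : Ω → ℝ}
    (hg : Measurable g) {c C : ℝ} (hc : 0 < c) (h : ∀ᵐ z ∂P, c ≤ g z) (h' : ∀ᵐ z ∂P, g z ≤ C) :
    Integrable (fun z => Real.log (g z)) P ∧
      ∫ z, Real.log (g z) ∂P ≤ Real.log (∫ z, g z ∂P) := by
  have hint : Integrable g P := Integrable.of_mem_Icc c C hg.aemeasurable
    (by filter_upwards [h, h'] with z h1 h2 using ⟨h1, h2⟩)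
  have hlog : Integrable (fun z => Real.log (g z)) P :=
    Integrable.of_mem_Icc (Real.log c) (Real.log C) (Real.measurable_log.comp hg).aemeasurable
      (by filter_upwards [h, h'] with z h1 h2 using
        ⟨Real.log_le_log hc h1, Real.log_le_log (hc.trans_le h1) h2⟩)
  refine ⟨hlog, ?_⟩
  set a := ∫ z, g z ∂P with ha
  have hapos : 0 < a := by
    have : ∫ _, c ∂P ≤ a := integral_mono_ae (integrable_const c) hint h
    simp at this
    linarith
  calc ∫ z, Real.log (g z) ∂P ≤ ∫ z, (g z / a + (Real.log a - 1)) ∂P := by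
        refine integral_mono_ae hlog ((hint.div_const a).add (integrable_const _)) ?_
        filter_upwards [h] with z hz
        have hz0 : 0 < g z := hc.trans_le hz
        have := Real.log_le_sub_one_of_pos (div_pos hz0 hapos)
        rw [Real.log_div hz0.ne' hapos.ne'] at this
        linarith
    _ = Real.log a := by
        rw [integral_add (hint.div_const a) (integrable_const _), integral_div, ← ha,
          div_self hapos.ne']
        simp

end MeasureTheory

/-! ### Relative entropy from the variational inequality. -/

namespace InformationTheory

variable {Ω : Type*} [MeasurableSpace Ω]

/-- Makes the truncated entropy integrands nonnegative, as Fatou requires. Below `a` this is `klFun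
≥ 0`; above `a`, `a ≥ e` gives `log a ≥ 1`. -/
theorem sub_one_le_mul_log_min_add {x a ε : ℝ} (hx : 0 ≤ x) (ha : Real.exp 1 ≤ a) (hε : 0 < ε) :
    x - 1 ≤ x * Real.log (min x a + ε) := by
  rcases hx.eq_or_lt with rfl | hx
  · simp
  have ha0 : 0 < a := (Real.exp_pos 1).trans_le ha
  have hlog : Real.log (min x a) ≤ Real.log (min x a + ε) :=
    Real.log_le_log (lt_min hx ha0) (by linarith)
  refine le_trans ?_ (mul_le_mul_of_nonneg_left hlog hx.le)
  rcases le_total x a with h | h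
  · rw [min_eq_left h]
    have := klFun_nonneg hx.le
    rw [klFun] at this
    linarith
  · rw [min_eq_right h]
    have : 1 ≤ Real.log a := by rwa [Real.le_log_iff_exp_le ha0]
    nlinarith

theorem tendsto_mul_log_min_add {x : ℝ} (hx : 0 ≤ x) :
    Tendsto (fun N : ℕ => x * Real.log (min x (N + 3) + 1 / ((N : ℝ) + 1))) atTop
      (𝓝 (x * Real.log x)) := by
  rcases hx.eq_or_lt with rfl | hx
  · simp
  have h1 : Tendsto (fun N : ℕ => x + 1 / ((N : ℝ) + 1)) atTop (𝓝 (x + 0)) :=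
    tendsto_const_nhds.add tendsto_one_div_add_atTop_nhds_zero_nat
  rw [add_zero] at h1
  refine ((h1.log hx.ne').const_mul x).congr' ?_
  obtain ⟨M, hM⟩ := exists_nat_ge x
  filter_upwards [eventually_ge_atTop M] with N hN
  have : (M : ℝ) ≤ N := by exact_mod_cast hN
  rw [min_eq_left (by linarith)]

/-- The half of the Donsker–Varadhan variational principle that bounds the relative entropy. -/
theorem klDiv_le_of_forall_integral_log_le {P Q : Measure Ω} [IsProbabilityMeasure P]
    [IsProbabilityMeasure Q] (hQP : Q ≪ P) {C : ℝ}
    (H : ∀ g : Ω → ℝ, Measurable g → (∃ c : ℝ, 0 < c ∧ ∀ z, c ≤ g z) → (∃ c : ℝ, ∀ z, g z ≤ c) →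
      ∫ z, Real.log (g z) ∂Q ≤ Real.log (∫ z, g z ∂P) + C) :
    klDiv Q P ≤ ENNReal.ofReal C := by
  set f : Ω → ℝ := fun z => (Q.rnDeriv P z).toReal with hf
  have hfm : Measurable f := (Measure.measurable_rnDeriv Q P).ennreal_toReal
  have hf0 : ∀ z, 0 ≤ f z := fun z => ENNReal.toReal_nonneg
  have hfint : Integrable f P := Measure.integrable_toReal_rnDeriv
  have hf1 : ∫ z, f z ∂P = 1 := by
    rw [hf, Measure.integral_toReal_rnDeriv hQP]; simp
  -- Admissible approximations of the density: the shift keeps them off zero, and the cap `N + 3`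
  -- exceeds `e` for every `N`.
  let g : ℕ → Ω → ℝ := fun N z => min (f z) (N + 3) + 1 / ((N : ℝ) + 1)
  have hgm : ∀ N, Measurable (g N) := fun N => (hfm.min measurable_const).add_const _
  have hε : ∀ N : ℕ, (0 : ℝ) < 1 / ((N : ℝ) + 1) := fun N => by positivity
  have hglow : ∀ (N : ℕ) z, 1 / ((N : ℝ) + 1) ≤ g N z := fun N z => by
    have : 0 ≤ min (f z) ((N : ℝ) + 3) := le_min (hf0 z) (by positivity)
    simp only [g]; linarith
  have hgup : ∀ (N : ℕ) z, g N z ≤ (N + 3) + 1 / ((N : ℝ) + 1) := fun N z => by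
    simp only [g]; gcongr; exact min_le_right _ _
  -- Since `∫ f dP = 1`, `log ∫ g N dP ≤ ∫ g N dP - 1 ≤ 1/(N+1)`, which is the error term.
  have hbound : ∀ N : ℕ, ∫⁻ z, ENNReal.ofReal (f z * Real.log (g N z) + 1 - f z) ∂P
      ≤ ENNReal.ofReal (1 / ((N : ℝ) + 1) + C) := by
    intro N
    have hlogint : Integrable (fun z => Real.log (g N z)) Q :=
      (integral_log_le_log_integral (hgm N) (hε N) (ae_of_all _ (hglow N))
        (ae_of_all _ (hgup N))).1
    have hi : Integrable (fun z => f z * Real.log (g N z)) P :=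
      (integrable_rnDeriv_smul_iff hQP (f := fun z => Real.log (g N z))).2 hlogint
    have he : ∫ z, f z * Real.log (g N z) ∂P = ∫ z, Real.log (g N z) ∂Q :=
      integral_rnDeriv_smul hQP (f := fun z => Real.log (g N z))
    have hi1 : Integrable (fun z => f z * Real.log (g N z) + 1) P := hi.add (integrable_const 1)
    have hFint : Integrable (fun z => f z * Real.log (g N z) + 1 - f z) P := hi1.sub hfint
    rw [← ofReal_integral_eq_lintegral_ofReal hFint (ae_of_all _ fun z => ?_)]
    · apply ENNReal.ofReal_le_ofReal
      have hsplit : ∫ z, (f z * Real.log (g N z) + 1 - f z) ∂P = ∫ z, Real.log (g N z) ∂Q := by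
        rw [integral_sub hi1 hfint, integral_add hi (integrable_const 1),
          he, hf1]
        simp
      have hgi : Integrable (g N) P := .of_measurable_of_bounds (hgm N) (hglow N) (hgup N)
      have hpos : 0 < ∫ z, g N z ∂P := by
        have := integral_mono (integrable_const (μ := P) (1 / ((N : ℝ) + 1))) hgi (hglow N)
        simp only [integral_const, probReal_univ, one_smul] at this
        exact (hε N).trans_le this
      have hle : ∫ z, g N z ∂P ≤ 1 + 1 / ((N : ℝ) + 1) := by
        calc ∫ z, g N z ∂P ≤ ∫ z, (f z + 1 / ((N : ℝ) + 1)) ∂P :=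
              integral_mono hgi (hfint.add (integrable_const _)) fun z => by
                simp only [g]; gcongr; exact min_le_left _ _
          _ = _ := by rw [integral_add hfint (integrable_const _), hf1]; simp
      have := H (g N) (hgm N) ⟨_, hε N, hglow N⟩ ⟨_, hgup N⟩
      have := Real.log_le_sub_one_of_pos hpos
      linarith
    · have : Real.exp 1 ≤ (N : ℝ) + 3 := by
        have := Real.exp_one_lt_d9
        have : (0 : ℝ) ≤ N := N.cast_nonneg
        linarith
      have := sub_one_le_mul_log_min_add (hf0 z) this (hε N)
      simp only [Pi.zero_apply, g]
      linarith
  rw [klDiv_eq_lintegral_klFun_of_ac hQP]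
  calc ∫⁻ z, ENNReal.ofReal (klFun (Q.rnDeriv P z).toReal) ∂P
      = ∫⁻ z, liminf (fun N : ℕ =>
          ENNReal.ofReal (f z * Real.log (g N z) + 1 - f z)) atTop ∂P := by
        refine lintegral_congr fun z => ?_
        refine (Tendsto.liminf_eq ?_).symm
        exact ENNReal.tendsto_ofReal
          (((tendsto_mul_log_min_add (hf0 z)).add_const 1).sub_const (f z))
    -- Fatou needs no integrability of `f log f`; finiteness of the entropy is a conclusion.
    _ ≤ liminf (fun N : ℕ =>
          ∫⁻ z, ENNReal.ofReal (f z * Real.log (g N z) + 1 - f z) ∂P) atTop := by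
        refine lintegral_liminf_le fun N => ?_
        have := hgm N
        fun_prop
    _ ≤ liminf (fun N : ℕ => ENNReal.ofReal (1 / ((N : ℝ) + 1) + C)) atTop :=
        liminf_le_liminf (Eventually.of_forall hbound)
    _ = ENNReal.ofReal C := by
        refine Tendsto.liminf_eq (ENNReal.tendsto_ofReal ?_)
        simpa using tendsto_one_div_add_atTop_nhds_zero_nat.add_const C

end InformationTheory

/-! ### The Mehler kernel and duality of the two semigroups. -/

namespace OrnsteinUhlenbeck

variable {n : ℕ} {t : ℝ}

theorem var_pos (ht : 0 < t) : 0 < var t := by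
  simpa [var] using ht

theorem mehler_pos (ht : 0 < t) (x y : EuclideanSpace ℝ (Fin n)) : 0 < mehler t x y := by
  have := var_pos ht
  unfold mehler
  positivity

theorem measurable_mehler :
    Measurable fun q : EuclideanSpace ℝ (Fin n) × EuclideanSpace ℝ (Fin n) =>
      mehler t q.1 q.2 := by
  unfold mehler
  fun_prop

theorem integral_mehler (ht : 0 < t) (x : EuclideanSpace ℝ (Fin n)) :
    ∫ y, mehler t x y = 1 := by
  have hv := var_pos ht
  have h2 : (0 : ℝ) < 2 * Real.pi * var t := by positivity
  have hG := GaussianFourier.integral_rexp_neg_mul_sq_norm (V := EuclideanSpace ℝ (Fin n))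
    (b := 1 / (2 * var t)) (by positivity)
  have hexp : ∀ y : EuclideanSpace ℝ (Fin n), Real.exp (-‖y‖ ^ 2 / (2 * var t))
      = Real.exp (-(1 / (2 * var t)) * ‖y‖ ^ 2) := fun y => by congr 1; ring
  simp only [mehler]
  rw [integral_const_mul,
    integral_sub_right_eq_self (fun y => Real.exp (-‖y‖ ^ 2 / (2 * var t)))]
  simp_rw [hexp]
  rw [hG, finrank_euclideanSpace, Fintype.card_fin,
    show Real.pi / (1 / (2 * var t)) = 2 * Real.pi * var t by field_simp, ← Real.rpow_add h2]
  simp [neg_div]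

theorem integrable_mehler (ht : 0 < t) (x : EuclideanSpace ℝ (Fin n)) :
    Integrable (mehler t x) :=
  .of_integral_ne_zero (by rw [integral_mehler ht x]; exact one_ne_zero)

theorem lintegral_mehler (ht : 0 < t) (x : EuclideanSpace ℝ (Fin n)) :
    ∫⁻ y, ENNReal.ofReal (mehler t x y) = 1 := by
  rw [← ofReal_integral_eq_lintegral_ofReal (integrable_mehler ht x)
    (ae_of_all _ fun y => (mehler_pos ht x y).le), integral_mehler ht, ENNReal.ofReal_one]

theorem measurable_lintegral_mehler (μ : Measure (EuclideanSpace ℝ (Fin n))) [SFinite μ] :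
    Measurable fun z => ∫⁻ x, ENNReal.ofReal (mehler t x z) ∂μ :=
  (measurable_mehler.ennreal_ofReal).lintegral_prod_left'

theorem lintegral_lintegral_mehler (ht : 0 < t) (μ : Measure (EuclideanSpace ℝ (Fin n)))
    [IsProbabilityMeasure μ] : ∫⁻ z, ∫⁻ x, ENNReal.ofReal (mehler t x z) ∂μ = 1 := by
  rw [lintegral_lintegral_swap (f := fun z x => ENNReal.ofReal (mehler t x z))
    (measurable_mehler.ennreal_ofReal.comp measurable_swap).aemeasurable]
  simp [lintegral_mehler ht]

theorem isProbabilityMeasure_evolve (ht : 0 < t) (μ : Measure (EuclideanSpace ℝ (Fin n)))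
    [IsProbabilityMeasure μ] : IsProbabilityMeasure (evolve t μ) :=
  ⟨by rw [evolve, withDensity_apply _ .univ, Measure.restrict_univ,
    lintegral_lintegral_mehler ht]⟩

/-- The kernel is strictly positive, so `evolve t μ` has an everywhere positive density and Lebesgue
measure is absolutely continuous with respect to it. -/
theorem evolve_absolutelyContinuous (ht : 0 < t) (μ ν : Measure (EuclideanSpace ℝ (Fin n)))
    [IsProbabilityMeasure μ] : evolve t ν ≪ evolve t μ := by
  refine (withDensity_absolutelyContinuous _ _).trans
    (withDensity_absolutelyContinuous' (measurable_lintegral_mehler μ).aemeasurable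
      (ae_of_all _ fun z => ?_))
  have hm : Measurable fun x => ENNReal.ofReal (mehler t x z) :=
    (measurable_mehler.comp (measurable_id.prodMk measurable_const)).ennreal_ofReal
  rw [Ne, lintegral_eq_zero_iff hm]
  intro h
  obtain ⟨x, hx⟩ := h.exists
  exact (ENNReal.ofReal_pos.2 (mehler_pos ht x z)).ne' hx

theorem integrable_mehler_mul (ht : 0 < t) (x : EuclideanSpace ℝ (Fin n))
    {h : EuclideanSpace ℝ (Fin n) → ℝ} (hm : Measurable h) {B : ℝ} (hB : ∀ z, |h z| ≤ B) :
    Integrable fun y => mehler t x y * h y :=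
  (integrable_mehler ht x).mul_bdd hm.aestronglyMeasurable (ae_of_all _ hB)

theorem measurable_semigroup {h : EuclideanSpace ℝ (Fin n) → ℝ} (hm : Measurable h) :
    Measurable (semigroup t h) :=
  (StronglyMeasurable.integral_prod_right'
    (f := fun q : EuclideanSpace ℝ (Fin n) × EuclideanSpace ℝ (Fin n) => mehler t q.1 q.2 * h q.2)
    (measurable_mehler.mul (hm.comp measurable_snd)).stronglyMeasurable).measurable

theorem le_semigroup (ht : 0 < t) (x : EuclideanSpace ℝ (Fin n))
    {h : EuclideanSpace ℝ (Fin n) → ℝ} (hm : Measurable h) {B c : ℝ} (hB : ∀ z, |h z| ≤ B)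
    (hc : ∀ z, c ≤ h z) : c ≤ semigroup t h x := by
  have := integral_mono ((integrable_mehler ht x).mul_const c) (integrable_mehler_mul ht x hm hB)
    fun y => mul_le_mul_of_nonneg_left (hc y) (mehler_pos ht x y).le
  rwa [integral_mul_const, integral_mehler ht, one_mul] at this

theorem semigroup_le (ht : 0 < t) (x : EuclideanSpace ℝ (Fin n))
    {h : EuclideanSpace ℝ (Fin n) → ℝ} (hm : Measurable h) {B c : ℝ} (hB : ∀ z, |h z| ≤ B)
    (hc : ∀ z, h z ≤ c) : semigroup t h x ≤ c := by
  have := integral_mono (integrable_mehler_mul ht x hm hB) ((integrable_mehler ht x).mul_const c)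
    fun y => mul_le_mul_of_nonneg_left (hc y) (mehler_pos ht x y).le
  rwa [integral_mul_const, integral_mehler ht, one_mul] at this

theorem integral_evolve (ht : 0 < t) (μ : Measure (EuclideanSpace ℝ (Fin n)))
    [IsProbabilityMeasure μ] {h : EuclideanSpace ℝ (Fin n) → ℝ} (hm : Measurable h) {B : ℝ}
    (hB : ∀ z, |h z| ≤ B) : ∫ z, h z ∂(evolve t μ) = ∫ x, semigroup t h x ∂μ := by
  have hmeas := measurable_mehler (n := n) (t := t)
  have hmint : Integrable (Function.uncurry (mehler t)) (μ.prod volume) := by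
    refine (integrable_prod_iff hmeas.aestronglyMeasurable).2
      ⟨ae_of_all _ fun x => integrable_mehler ht x, ?_⟩
    have : ∀ x : EuclideanSpace ℝ (Fin n), ∫ y, ‖Function.uncurry (mehler t) (x, y)‖ = 1 := fun x => by
      rw [← integral_mehler ht x]
      exact integral_congr_ae (ae_of_all _ fun y => abs_of_pos (mehler_pos ht x y))
    exact (integrable_const (1 : ℝ)).congr (ae_of_all _ fun x => (this x).symm)
  have hint : Integrable (Function.uncurry fun x y => mehler t x y * h y) (μ.prod volume) :=
    hmint.mul_bdd (hm.comp measurable_snd).aestronglyMeasurable (ae_of_all _ fun q => hB q.2)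
  have hfin := lintegral_lintegral_mehler ht μ
  rw [evolve, integral_withDensity_eq_integral_toReal_smul (measurable_lintegral_mehler μ)
    (ae_lt_top (measurable_lintegral_mehler μ) (by rw [hfin]; exact ENNReal.one_ne_top))]
  simp only [semigroup]
  rw [integral_integral_swap hint]
  refine integral_congr_ae (ae_of_all _ fun z => ?_)
  simp only [smul_eq_mul]
  rw [integral_mul_const, integral_eq_lintegral_of_nonneg_ae
    (ae_of_all _ fun x => (mehler_pos ht x z).le)
    (hmeas.comp (measurable_id.prodMk measurable_const)).aestronglyMeasurable]

end OrnsteinUhlenbeck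

/-! ### Couplings and Wasserstein distances. -/

namespace OptimalTransport

section General

variable {X : Type*} [MeasurableSpace X] {μ ν : Measure X} {γ : Measure (X × X)}

theorem IsCoupling.isProbabilityMeasure [IsProbabilityMeasure μ] (h : IsCoupling γ μ ν) :
    IsProbabilityMeasure γ :=
  ⟨by rw [← measure_univ (μ := μ), ← h.1, Measure.map_apply measurable_fst .univ,
    Set.preimage_univ]⟩

theorem isCoupling_prod (μ ν : Measure X) [IsProbabilityMeasure μ] [IsProbabilityMeasure ν] :
    IsCoupling (μ.prod ν) μ ν :=
  ⟨by simp, by simp⟩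

theorem IsCoupling.ae_mem {K : Set X} (h : IsCoupling γ μ ν) (hμ : μ Kᶜ = 0) (hν : ν Kᶜ = 0) :
    ∀ᵐ q ∂γ, q.1 ∈ K ∧ q.2 ∈ K := by
  have h1 : ∀ᵐ x ∂(γ.map Prod.fst), x ∈ K := by rw [h.1]; exact hμ
  have h2 : ∀ᵐ x ∂(γ.map Prod.snd), x ∈ K := by rw [h.2]; exact hν
  exact (ae_of_ae_map measurable_fst.aemeasurable h1).and
    (ae_of_ae_map measurable_snd.aemeasurable h2)

end General

theorem wasserstein_one_le_wasserstein_two {X : Type*} [PseudoEMetricSpace X] [MeasurableSpace X]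
    [OpensMeasurableSpace X] [SecondCountableTopology X] (μ ν : Measure X)
    [IsProbabilityMeasure μ] : wasserstein 1 μ ν ≤ wasserstein 2 μ ν := by
  unfold wasserstein
  -- The square root is moved across so that one coupling can be fixed; Hölder against the constant
  -- `1` then applies to it.
  rw [one_div_one, ENNReal.rpow_one, one_div, ENNReal.le_rpow_inv_iff two_pos]
  refine le_iInf fun γ => ?_
  rw [← ENNReal.le_rpow_inv_iff two_pos]
  refine (iInf_le _ γ).trans ?_
  have := γ.2.isProbabilityMeasure
  have hold := ENNReal.lintegral_mul_le_Lp_mul_Lq γ.1 Real.HolderConjugate.two_two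
    (f := fun q : X × X => edist q.1 q.2) (g := fun _ => 1) measurable_edist.aemeasurable
    aemeasurable_const
  simpa using hold

end OptimalTransport

/-! ### The entropy-cost inequality. -/

namespace OrnsteinUhlenbeck

open OptimalTransport

theorem klDiv_evolve_le_of_isCoupling {n : ℕ} {t : ℝ} (ht : 0 < t)
    {K : Set (EuclideanSpace ℝ (Fin n))} (hK : Bornology.IsBounded K) {S : ℝ≥0}
    (hS : LogHarnackOn t K (S : ℝ)) {μ ν : Measure (EuclideanSpace ℝ (Fin n))}
    [IsProbabilityMeasure μ] [IsProbabilityMeasure ν] (hμ : μ Kᶜ = 0) (hν : ν Kᶜ = 0)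
    {γ : Measure (EuclideanSpace ℝ (Fin n) × EuclideanSpace ℝ (Fin n))}
    (hγ : IsCoupling γ μ ν) :
    klDiv (evolve t ν) (evolve t μ) ≤ ∫⁻ q, edist q.1 q.2 * (S : ℝ≥0∞) ∂γ := by
  have := hγ.isProbabilityMeasure
  have := isProbabilityMeasure_evolve ht μ
  have := isProbabilityMeasure_evolve ht ν
  have hmem := hγ.ae_mem hμ hν
  -- Boundedness of `K` makes the cost finite, so it can serve as the real constant `C`.
  have hdist : Integrable (fun q : EuclideanSpace ℝ (Fin n) × EuclideanSpace ℝ (Fin n) =>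
      (S : ℝ) * dist q.1 q.2) γ := by
    refine Integrable.const_mul (Integrable.of_mem_Icc 0 (Metric.diam K)
      measurable_dist.aemeasurable ?_) _
    filter_upwards [hmem] with q hq using ⟨dist_nonneg, Metric.dist_le_diam_of_mem hK hq.1 hq.2⟩
  have hcost : ∫⁻ q, edist q.1 q.2 * (S : ℝ≥0∞) ∂γ
      = ENNReal.ofReal (∫ q, (S : ℝ) * dist q.1 q.2 ∂γ) := by
    rw [ofReal_integral_eq_lintegral_ofReal hdist (ae_of_all _ fun q => by positivity)]
    refine lintegral_congr fun q => ?_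
    rw [ENNReal.ofReal_mul S.coe_nonneg, ENNReal.ofReal_coe_nnreal, ← edist_dist, mul_comm]
  rw [hcost]
  refine klDiv_le_of_forall_integral_log_le (evolve_absolutelyContinuous ht μ ν) ?_
  rintro g hg ⟨c, hc, hgc⟩ ⟨C, hgC⟩
  have hgB : ∀ z, |g z| ≤ C := fun z => by
    rw [abs_of_pos (hc.trans_le (hgc z))]; exact hgC z
  have hlm : Measurable fun z => Real.log (g z) := Real.measurable_log.comp hg
  have hlB : ∀ z, |Real.log (g z)| ≤ max |Real.log c| |Real.log C| := fun z =>
    abs_le_max_abs_abs (Real.log_le_log hc (hgc z))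
      (Real.log_le_log (hc.trans_le (hgc z)) (hgC z))
  have hlow : ∀ x, c ≤ semigroup t g x := fun x => le_semigroup ht x hg hgB hgc
  have hup : ∀ x, semigroup t g x ≤ C := fun x => semigroup_le ht x hg hgB hgC
  rw [integral_evolve ht ν hlm hlB, integral_evolve ht μ hg hgB]
  have hPlm : Measurable (semigroup t fun z => Real.log (g z)) := measurable_semigroup hlm
  have hPgm : Measurable (semigroup t g) := measurable_semigroup hg
  have hPl : Integrable (fun q : EuclideanSpace ℝ (Fin n) × EuclideanSpace ℝ (Fin n) =>
      semigroup t (fun z => Real.log (g z)) q.2) γ :=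
    .of_measurable_of_bounds (hPlm.comp measurable_snd)
      (fun q => le_semigroup ht q.2 hlm hlB fun z => (abs_le.1 (hlB z)).1)
      (fun q => semigroup_le ht q.2 hlm hlB fun z => (abs_le.1 (hlB z)).2)
  obtain ⟨-, hjensen⟩ := integral_log_le_log_integral (P := μ) hPgm hc (ae_of_all _ hlow)
    (ae_of_all _ hup)
  obtain ⟨hlogP, -⟩ := integral_log_le_log_integral (P := γ) (hPgm.comp measurable_fst) hc
    (ae_of_all _ fun q => hlow q.1) (ae_of_all _ fun q => hup q.1)
  have e1 : ∫ y, semigroup t (fun z => Real.log (g z)) y ∂ν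
      = ∫ q, semigroup t (fun z => Real.log (g z)) q.2 ∂γ := by
    rw [← hγ.2, integral_map measurable_snd.aemeasurable hPlm.aestronglyMeasurable]
  have e2 : ∫ x, Real.log (semigroup t g x) ∂μ
      = ∫ q, Real.log (semigroup t g q.1) ∂γ := by
    conv_lhs => rw [← hγ.1]
    exact integral_map measurable_fst.aemeasurable
      (Real.measurable_log.comp hPgm).aestronglyMeasurable
  have hharnack : ∫ q, semigroup t (fun z => Real.log (g z)) q.2 ∂γ
      ≤ ∫ q, (Real.log (semigroup t g q.1) + S * dist q.1 q.2) ∂γ := by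
    refine integral_mono_ae hPl (hlogP.add hdist) ?_
    filter_upwards [hmem] with q hq using hS g hg ⟨c, hc, hgc⟩ ⟨C, hgC⟩ q.1 hq.1 q.2 hq.2
  have hsplit : ∫ q, (Real.log (semigroup t g q.1) + S * dist q.1 q.2) ∂γ
      = ∫ q, Real.log (semigroup t g q.1) ∂γ + ∫ q, (S : ℝ) * dist q.1 q.2 ∂γ :=
    integral_add hlogP hdist
  linarith

end OrnsteinUhlenbeck

theorem mainTheorem6 (n : ℕ) (t : ℝ) (ht : 0 < t) (K : Set (EuclideanSpace ℝ (Fin n)))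
    (hK : IsCompact K) (S : ℝ≥0) (hS : OrnsteinUhlenbeck.LogHarnackOn t K (S : ℝ))
    (μ ν : MeasureTheory.Measure (EuclideanSpace ℝ (Fin n)))
    [MeasureTheory.IsProbabilityMeasure μ] [MeasureTheory.IsProbabilityMeasure ν]
    (hμ : μ Kᶜ = 0) (hν : ν Kᶜ = 0) :
    (∀ γ : MeasureTheory.Measure (EuclideanSpace ℝ (Fin n) × EuclideanSpace ℝ (Fin n)),
      OptimalTransport.IsCoupling γ μ ν →
        InformationTheory.klDiv (OrnsteinUhlenbeck.evolve t ν) (OrnsteinUhlenbeck.evolve t μ)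
            ≤ ∫⁻ q, edist q.1 q.2 * (S : ℝ≥0∞) ∂γ ∧
        ∫⁻ q, edist q.1 q.2 * (S : ℝ≥0∞) ∂γ = (S : ℝ≥0∞) * ∫⁻ q, edist q.1 q.2 ∂γ) ∧
    InformationTheory.klDiv (OrnsteinUhlenbeck.evolve t ν) (OrnsteinUhlenbeck.evolve t μ)
        ≤ (S : ℝ≥0∞) * OptimalTransport.wasserstein 1 μ ν ∧
    (S : ℝ≥0∞) * OptimalTransport.wasserstein 1 μ ν
        ≤ (S : ℝ≥0∞) * OptimalTransport.wasserstein 2 μ ν := by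
  have hcoup : ∀ γ : MeasureTheory.Measure (EuclideanSpace ℝ (Fin n) × EuclideanSpace ℝ (Fin n)),
      OptimalTransport.IsCoupling γ μ ν →
        InformationTheory.klDiv (OrnsteinUhlenbeck.evolve t ν) (OrnsteinUhlenbeck.evolve t μ)
            ≤ ∫⁻ q, edist q.1 q.2 * (S : ℝ≥0∞) ∂γ ∧
        ∫⁻ q, edist q.1 q.2 * (S : ℝ≥0∞) ∂γ = (S : ℝ≥0∞) * ∫⁻ q, edist q.1 q.2 ∂γ := by
    refine fun γ hγ =>
      ⟨OrnsteinUhlenbeck.klDiv_evolve_le_of_isCoupling ht hK.isBounded hS hμ hν hγ, ?_⟩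
    rw [lintegral_mul_const _ measurable_edist, mul_comm]
  refine ⟨hcoup, ?_, mul_le_mul_right
    (OptimalTransport.wasserstein_one_le_wasserstein_two μ ν) _⟩
  -- Without a coupling the infimum would be `∞`, and `S = 0` could not be moved inside it.
  have : Nonempty {γ // OptimalTransport.IsCoupling γ μ ν} :=
    ⟨⟨_, OptimalTransport.isCoupling_prod μ ν⟩⟩
  unfold OptimalTransport.wasserstein
  rw [one_div_one, ENNReal.rpow_one, ENNReal.mul_iInf (by simp)]
  refine le_iInf fun γ => ?_
  simp only [ENNReal.rpow_one]
  rw [← (hcoup γ.1 γ.2).2]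
  exact (hcoup γ.1 γ.2).1
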